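/- Let $F$ be a field of arbitrary characteristic and let $C$ be a split Cayley–Dickson algebra over $F$: a unital nonassociative $F$-algebra that contains zero divisors and is isomorphic to some $C(\mu,\beta,\gamma)$ ($4\mu+1\neq0$, $\beta,\gamma\neq 0$), the algebra obtained from $K(\mu)=F+Fi$, $i^2=\mu+i$, $\bar i=1-i$, by the Cayley–Dickson process applied twice, with parameters $\beta$ and then $\gamma$. (The center of $C$ is then $F\cdot 1$.) Let $x\mapsto\bar x$ be its involution, let $t(x)1=x+\bar x$ and $n(x)1=x\bar x$ be its trace and norm, let $f(x,y)=n(x+y)-n(x)-n(y)$, and let $M^{\perp}$ denote the orthogonal complement of $M$ with respect to $f$. A derivation with invertible values of $C$ is a nonzero $F$-linear derivation $d:C\to C$ such that every $d(x)$ is either $0$ or invertible. Subalgebras below are $F$-subalgebras, and division subalgebras and subfields contain the unit element of $C$. Consider the following conditions. (I) [for $B$, $v$, $\gamma$] $B$ is an associative division subalgebra of $C$ with $\dim_F B=4$, $v\in C$, $0\neq\gamma\in F$, and $C$ is obtained from $B$ by the Cayley–Dickson process: $v^2=\gamma$, every element of $C$ is uniquely of the form $a+vb$ with $a,b\in B$,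 and $(a_1+vb_1)(a_2+vb_2)=(a_1a_2+\gamma b_2\bar b_1)+v(\bar a_1b_2+a_2b_1)$ for all $a_i,b_i\in B$. (II) [for $B$, $x$] $B$ is a subfield and subalgebra of $C$ with $\dim_F B=4$ and $B=B^{\perp}$, $x\in C$, $t(x)=0$, and every element of $C$ is uniquely of the form $a+xb$ with $a,b\in B$. Then: (1) $C$ admits a derivation with invertible values if and only if (I) holds for some $B,v,\gamma$ or (II) holds for some $B,x$. (2) If $d$ is a derivation with invertible values, then $B=\ker d$ is a subalgebra for which (I) holds with some $v,\gamma$ or (II) holds with some $x$. (3) Suppose that (I) holds for $B,v,\gamma$. Every derivation $d$ with invertible values such that $\ker d=B$ has the form $d(a+vb)=v(bu)$ $(a,b\in B)$ for a fixed $0\neq u\in B$ with $t(u)=0$. Conversely, nonzero elements $u \in B$ with $t(u)=0$ exist, and for each of them this formula defines a derivation with invertible values whose kernel is $B$. (4) Suppose that (II) holds for $B,x$. Then $\operatorname{char}F=2$. Every derivation $d$ with invertible values such that $\ker d=B$ has the form $d(a+x'b)=b$ $(a,b\in B)$ for some $x'\in C$ such that (II) holds for $B,x'$. Conversely, the formula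 $d(a+xb)=b$ defines a derivation with invertible values whose kernel is $B$. -/

import Mathlib

open scoped Quaternion

/-! ### Cayley–Dickson algebras

Over a field `F` of any characteristic, the algebra `K(μ) = F + F i`, `i² = μ + i`
(with `4μ + 1 ≠ 0` and involution `i ↦ 1 - i`), doubled with the parameter `β ≠ 0`, is the
quaternion algebra `Q(μ, β) = ℍ[F,μ,1,β]`, with involution `star`.  A further double, with the
parameter `γ ≠ 0`, gives the Cayley–Dickson algebra `C(μ, β, γ)`. -/

/-- The Cayley–Dickson algebra `C(μ, β, γ)`: pairs `(a, b)`, thought of as `a + v b`, of elements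
of the quaternion algebra `Q(μ, β)`, with the multiplication of the Cayley–Dickson process,
`(a₁ + v b₁)(a₂ + v b₂) = (a₁ a₂ + γ b₂ b̄₁) + v (ā₁ b₂ + a₂ b₁)`. -/
@[ext]
structure CayleyDickson (F : Type*) (μ β γ : F) [One F] where
  fst : ℍ[F,μ,1,β]
  snd : ℍ[F,μ,1,β]

namespace CayleyDickson

variable {F : Type*} [Field F] {μ β γ : F}

instance : Zero (CayleyDickson F μ β γ) := ⟨⟨0, 0⟩⟩
instance : One (CayleyDickson F μ β γ) := ⟨⟨1, 0⟩⟩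
instance : Add (CayleyDickson F μ β γ) := ⟨fun x y => ⟨x.fst + y.fst, x.snd + y.snd⟩⟩
instance : Neg (CayleyDickson F μ β γ) := ⟨fun x => ⟨-x.fst, -x.snd⟩⟩
instance : SMul F (CayleyDickson F μ β γ) := ⟨fun r x => ⟨r • x.fst, r • x.snd⟩⟩
instance : Mul (CayleyDickson F μ β γ) :=
  ⟨fun x y => ⟨x.fst * y.fst + γ • (y.snd * star x.snd), star x.fst * y.snd + y.fst * x.snd⟩⟩

@[simp] theorem fst_zero : (0 : CayleyDickson F μ β γ).fst = 0 := rfl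
@[simp] theorem snd_zero : (0 : CayleyDickson F μ β γ).snd = 0 := rfl
@[simp] theorem fst_one : (1 : CayleyDickson F μ β γ).fst = 1 := rfl
@[simp] theorem snd_one : (1 : CayleyDickson F μ β γ).snd = 0 := rfl
@[simp] theorem fst_add (x y : CayleyDickson F μ β γ) : (x + y).fst = x.fst + y.fst := rfl
@[simp] theorem snd_add (x y : CayleyDickson F μ β γ) : (x + y).snd = x.snd + y.snd := rfl
@[simp] theorem fst_neg (x : CayleyDickson F μ β γ) : (-x).fst = -x.fst := rfl
@[simp] theorem snd_neg (x : CayleyDickson F μ β γ) : (-x).snd = -x.snd := rfl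
@[simp] theorem fst_smul (r : F) (x : CayleyDickson F μ β γ) : (r • x).fst = r • x.fst := rfl
@[simp] theorem snd_smul (r : F) (x : CayleyDickson F μ β γ) : (r • x).snd = r • x.snd := rfl
@[simp] theorem fst_mul (x y : CayleyDickson F μ β γ) :
    (x * y).fst = x.fst * y.fst + γ • (y.snd * star x.snd) := rfl
@[simp] theorem snd_mul (x y : CayleyDickson F μ β γ) :
    (x * y).snd = star x.fst * y.snd + y.fst * x.snd := rfl

instance : NonAssocRing (CayleyDickson F μ β γ) where
  add_assoc x y z := by ext1 <;> simp [add_assoc]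
  zero_add x := by ext1 <;> simp
  add_zero x := by ext1 <;> simp
  add_comm x y := by ext1 <;> simp [add_comm]
  nsmul := nsmulRec
  zsmul := zsmulRec
  neg_add_cancel x := by ext1 <;> simp
  left_distrib x y z := by ext1 <;> simp [mul_add, add_mul] <;> abel
  right_distrib x y z := by ext1 <;> simp [mul_add, add_mul] <;> abel
  zero_mul x := by ext1 <;> simp
  mul_zero x := by ext1 <;> simp
  one_mul x := by ext1 <;> simp
  mul_one x := by ext1 <;> simp

instance : Module F (CayleyDickson F μ β γ) where
  one_smul x := by ext1 <;> simp
  mul_smul r s x := by ext1 <;> simp [mul_smul]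
  smul_zero r := by ext1 <;> simp
  smul_add r x y := by ext1 <;> simp
  add_smul r s x := by ext1 <;> simp [add_smul]
  zero_smul x := by ext1 <;> simp

instance : IsScalarTower F (CayleyDickson F μ β γ) (CayleyDickson F μ β γ) where
  smul_assoc r x y := by
    ext1 <;> simp [smul_comm γ r]

instance : SMulCommClass F (CayleyDickson F μ β γ) (CayleyDickson F μ β γ) where
  smul_comm r x y := by
    ext1 <;> simp [smul_comm γ r]

/-- The involution `a + v b ↦ ā - v b`. -/
instance : Star (CayleyDickson F μ β γ) := ⟨fun x => ⟨star x.fst, -x.snd⟩⟩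

/-- The trace of `x`: the scalar `t(x)` with `x + x̄ = t(x) 1`. -/
def trace (x : CayleyDickson F μ β γ) : F := (x + star x).fst.re

/-- The norm of `x`: the scalar `n(x)` with `x x̄ = n(x) 1`. -/
def norm (x : CayleyDickson F μ β γ) : F := (x * star x).fst.re

theorem add_star_self (x : CayleyDickson F μ β γ) : x + star x = trace x • 1 := by
  rcases x with ⟨⟨a, b, c, d⟩, ⟨a', b', c', d'⟩⟩
  ext <;> simp [trace, star]

theorem mul_star_self (x : CayleyDickson F μ β γ) : x * star x = norm x • 1 := by
  rcases x with ⟨⟨a, b, c, d⟩, ⟨a', b', c', d'⟩⟩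
  ext <;> simp [norm, star] <;> ring

/-- Every element satisfies `x² - t(x) x + n(x) = 0`. -/
theorem mul_self_sub_trace_add_norm (x : CayleyDickson F μ β γ) :
    x * x - trace x • x + norm x • 1 = 0 := by
  have h : x * (x + star x) = trace x • x := by rw [add_star_self, mul_smul_comm, mul_one]
  rw [← mul_star_self, ← h, mul_add]
  abel

end CayleyDickson

/-- A Cayley–Dickson algebra over the field `F`: a unital nonassociative `F`-algebra `C` together
with an isomorphism to some `C(μ, β, γ)`. -/
structure CayleyDicksonStructure (F C : Type*) [Field F] [NonAssocRing C] [Module F C] where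
  μ : F
  β : F
  γ : F
  four_mul_add_one_ne_zero : 4 * μ + 1 ≠ 0
  β_ne_zero : β ≠ 0
  γ_ne_zero : γ ≠ 0
  equiv : C ≃ₗ[F] CayleyDickson F μ β γ
  map_mul : ∀ x y, equiv (x * y) = equiv x * equiv y

section

variable {F C : Type*} [Field F] [NonAssocRing C] [Module F C]

namespace CayleyDicksonStructure

variable (S : CayleyDicksonStructure F C)

/-- The trace `t` of `C`. -/
def trace (x : C) : F := (S.equiv x).trace

/-- The norm `n` of `C`. -/
def norm (x : C) : F := (S.equiv x).norm

/-- The involution `x ↦ x̄ = t(x) 1 - x` of `C`. -/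
def conj (x : C) : C := S.trace x • (1 : C) - x

/-- The bilinear form `f(x, y) = n(x + y) - n(x) - n(y)`. -/
def form (x y : C) : F := S.norm (x + y) - S.norm x - S.norm y

/-- The orthogonal complement of a subset with respect to `f`. -/
def orthogonal (M : Set C) : Set C := {x | ∀ y ∈ M, S.form x y = 0}

end CayleyDicksonStructure

/-- `C` contains zero divisors. -/
def IsSplitAlgebra (C : Type*) [NonAssocRing C] : Prop :=
  ∃ x y : C, x ≠ 0 ∧ y ≠ 0 ∧ x * y = 0

/-- `x` has a two-sided inverse. -/
def IsInvertibleElement (x : C) : Prop := ∃ y : C, x * y = 1 ∧ y * x = 1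

/-- A nonzero derivation of the `F`-algebra `C` all of whose values are `0` or invertible. -/
structure IsDerivationWithInvertibleValues (d : C →ₗ[F] C) : Prop where
  leibniz : ∀ x y, d (x * y) = d x * y + x * d y
  ne_zero : d ≠ 0
  values : ∀ x, d x = 0 ∨ IsInvertibleElement (d x)

/-- `B` is an associative division subalgebra of `C` (with the unit element of `C`). -/
structure IsAssociativeDivisionSubalgebra (B : NonUnitalSubalgebra F C) : Prop where
  one_mem : (1 : C) ∈ B
  mul_assoc : ∀ a ∈ B, ∀ b ∈ B, ∀ c ∈ B, a * b * c = a * (b * c)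
  exists_inv : ∀ a ∈ B, a ≠ 0 → ∃ b ∈ B, a * b = 1 ∧ b * a = 1

/-- `B` is a subfield of `C`. -/
structure IsSubfieldOf (B : NonUnitalSubalgebra F C) : Prop
    extends IsAssociativeDivisionSubalgebra B where
  mul_comm : ∀ a ∈ B, ∀ b ∈ B, a * b = b * a

/-- `C = B ⊕ wB`: every element of `C` is `a + w b` for exactly one pair `a, b ∈ B`. -/
def IsDirectSumWith (B : NonUnitalSubalgebra F C) (w : C) : Prop :=
  Function.Bijective fun p : B × B => (p.1 : C) + w * (p.2 : C)

/-- Condition (I): `B` is a 4-dimensional associative division subalgebra, and `C = B + vB` is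
obtained from `B`, with the involution of `C`, by the Cayley–Dickson process with
`v² = γ ≠ 0`. -/
structure IsDoubleOfDivisionSubalgebra (S : CayleyDicksonStructure F C)
    (B : NonUnitalSubalgebra F C) (v : C) (γ : F) : Prop where
  division : IsAssociativeDivisionSubalgebra B
  finrank_eq : Module.finrank F B = 4
  γ_ne_zero : γ ≠ 0
  mul_self : v * v = γ • (1 : C)
  directSum : IsDirectSumWith B v
  mul_eq : ∀ a₁ ∈ B, ∀ b₁ ∈ B, ∀ a₂ ∈ B, ∀ b₂ ∈ B,
    (a₁ + v * b₁) * (a₂ + v * b₂) =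
      (a₁ * a₂ + γ • (b₂ * S.conj b₁)) + v * (S.conj a₁ * b₂ + a₂ * b₁)

/-- Condition (II): `C = B ⊕ xB` with `t(x) = 0`, where `B` is a 4-dimensional subfield with
`B = B^⊥`. -/
structure IsSumOverSelfOrthogonalSubfield (S : CayleyDicksonStructure F C)
    (B : NonUnitalSubalgebra F C) (x : C) : Prop where
  subfield : IsSubfieldOf B
  finrank_eq : Module.finrank F B = 4
  self_orthogonal : (B : Set C) = S.orthogonal B
  trace_eq_zero : S.trace x = 0
  directSum : IsDirectSumWith B x

end

/-! An element is invertible exactly when its norm is nonzero, so everything is read off from the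
composition form `n`. Let `d` be a derivation with invertible values and `B = ker d`. The image of
`d` is anisotropic by hypothesis. So is `B`: if `dx = 0` and `n(x) = 0`, each `d(xy) = x d(y)` has
norm zero, hence vanishes, and an invertible `d(y)` forces `x = 0`. Splitness gives a totally
isotropic subspace of dimension 4, which bounds both dimensions by 4; as they add up to 8, both
equal 4. A 4-dimensional anisotropic subalgebra containing 1 is spanned by some `1, a, v, av`, and
alternativity makes it associative.

Applying `d` to `x² - t(x)x + n(x) = 0` shows that `d` is skew for `f` with traceless values, so
`d(C)` is orthogonal to `B`. The radical of `f` on `B` is an ideal of a division algebra. If it is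
0, any nonzero `d(y)` is an anisotropic vector orthogonal to `B` and doubles it: case (I). If it is
`B`, then `2 = t(1) = 0`, the involution is trivial on `B`, `B` is commutative, and `B = B^⊥ = d(C)`
contains 1, so some `x` has `dx = 1`: case (II).

In both cases `d(a + wb) = d(w)b`, so `d` is determined by its value on the generator. The converses
expand products by the linearized composition identities (`conj_mul_mul_add`, `mul_mul_conj_add`).
-/

set_option linter.unusedSectionVars false

/-! ### Coordinate identities in `C(μ, β, γ)` -/

namespace CayleyDickson

variable {F : Type*} [Field F] {μ β γ : F}

theorem star_mul_mul_self (x y : CayleyDickson F μ β γ) : star x * (x * y) = norm x • y := by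
  rcases x with ⟨⟨a, b, c, d⟩, ⟨a', b', c', d'⟩⟩
  rcases y with ⟨⟨p, q, r, s⟩, ⟨p', q', r', s'⟩⟩
  ext <;> simp [norm, star] <;> ring

set_option maxHeartbeats 1000000 in
theorem mul_self_mul_star (x y : CayleyDickson F μ β γ) : y * x * star x = norm x • y := by
  rcases x with ⟨⟨a, b, c, d⟩, ⟨a', b', c', d'⟩⟩
  rcases y with ⟨⟨p, q, r, s⟩, ⟨p', q', r', s'⟩⟩
  ext <;> simp [norm, star] <;> ring

theorem norm_mul (x y : CayleyDickson F μ β γ) : norm (x * y) = norm x * norm y := by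
  rcases x with ⟨⟨a, b, c, d⟩, ⟨a', b', c', d'⟩⟩
  rcases y with ⟨⟨p, q, r, s⟩, ⟨p', q', r', s'⟩⟩
  simp [norm, star]
  ring

theorem norm_smul (r : F) (x : CayleyDickson F μ β γ) : norm (r • x) = r ^ 2 * norm x := by
  rcases x with ⟨⟨a, b, c, d⟩, ⟨a', b', c', d'⟩⟩
  simp [norm, star]
  ring

/-- The polar form of the norm, as a bilinear map. -/
def polar : LinearMap.BilinForm F (CayleyDickson F μ β γ) :=
  LinearMap.mk₂ F (fun x y => norm (x + y) - norm x - norm y)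
    (by rintro ⟨⟨a, b, c, d⟩, ⟨a', b', c', d'⟩⟩ ⟨⟨e, f, g, h⟩, ⟨e', f', g', h'⟩⟩
          ⟨⟨p, q, r, s⟩, ⟨p', q', r', s'⟩⟩
        simp [norm, star]; ring)
    (by rintro k ⟨⟨a, b, c, d⟩, ⟨a', b', c', d'⟩⟩ ⟨⟨p, q, r, s⟩, ⟨p', q', r', s'⟩⟩
        simp [norm, star]; ring)
    (by rintro ⟨⟨a, b, c, d⟩, ⟨a', b', c', d'⟩⟩ ⟨⟨e, f, g, h⟩, ⟨e', f', g', h'⟩⟩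
          ⟨⟨p, q, r, s⟩, ⟨p', q', r', s'⟩⟩
        simp [norm, star]; ring)
    (by rintro k ⟨⟨a, b, c, d⟩, ⟨a', b', c', d'⟩⟩ ⟨⟨p, q, r, s⟩, ⟨p', q', r', s'⟩⟩
        simp [norm, star]; ring)

theorem polar_apply (x y : CayleyDickson F μ β γ) :
    polar x y = norm (x + y) - norm x - norm y := rfl

theorem polar_one (x : CayleyDickson F μ β γ) : polar x 1 = trace x := by
  rcases x with ⟨⟨a, b, c, d⟩, ⟨a', b', c', d'⟩⟩
  simp [polar_apply, trace, norm, star]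
  ring

theorem norm_one : norm (1 : CayleyDickson F μ β γ) = 1 := by
  simp [norm, star]

/-- The Gram matrix of `f` splits into four blocks, each a nonzero multiple of one with determinant
`-(4μ + 1)` up to sign; this argument is uniform in the characteristic. -/
theorem eq_zero_of_polar_eq_zero (hμ : 4 * μ + 1 ≠ 0) (hβ : β ≠ 0) (hγ : γ ≠ 0)
    {x : CayleyDickson F μ β γ} (h : ∀ y, polar x y = 0) : x = 0 := by
  have key : ∀ {p q : F}, 2 * p + q = 0 → p - 2 * μ * q = 0 → p = 0 ∧ q = 0 := by
    intro p q h₁ h₂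
    have hq : (4 * μ + 1) * q = 0 := by linear_combination h₁ - 2 * h₂
    have hq' := (mul_eq_zero.mp hq).resolve_left hμ
    subst hq'
    exact ⟨by simpa using h₂, rfl⟩
  rcases x with ⟨⟨a, b, c, d⟩, ⟨a', b', c', d'⟩⟩
  have h1 := h ⟨⟨1, 0, 0, 0⟩, 0⟩
  have h2 := h ⟨⟨0, 1, 0, 0⟩, 0⟩
  have h3 := h ⟨⟨0, 0, 1, 0⟩, 0⟩
  have h4 := h ⟨⟨0, 0, 0, 1⟩, 0⟩
  have h5 := h ⟨0, ⟨1, 0, 0, 0⟩⟩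
  have h6 := h ⟨0, ⟨0, 1, 0, 0⟩⟩
  have h7 := h ⟨0, ⟨0, 0, 1, 0⟩⟩
  have h8 := h ⟨0, ⟨0, 0, 0, 1⟩⟩
  simp [polar_apply, norm, star] at h1 h2 h3 h4 h5 h6 h7 h8
  obtain ⟨r1, r2⟩ := key (p := a) (q := b) (by linear_combination h1) (by linear_combination h2)
  obtain ⟨r3, r4⟩ := key (p := c) (q := d)
    (mul_left_cancel₀ hβ (by linear_combination -h3))
    (mul_left_cancel₀ hβ (by linear_combination -h4))
  obtain ⟨r5, r6⟩ := key (p := a') (q := b')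
    (mul_left_cancel₀ hγ (by linear_combination -h5))
    (mul_left_cancel₀ hγ (by linear_combination -h6))
  obtain ⟨r7, r8⟩ := key (p := c') (q := d')
    (mul_left_cancel₀ (mul_ne_zero hγ hβ) (by linear_combination h7))
    (mul_left_cancel₀ (mul_ne_zero hγ hβ) (by linear_combination h8))
  subst r1 r2 r3 r4 r5 r6 r7 r8
  rfl

/-- The underlying vector space of `C(μ, β, γ)` is the sum of two copies of `Q(μ, β)`. -/
def linearEquivProd : CayleyDickson F μ β γ ≃ₗ[F] ℍ[F,μ,1,β] × ℍ[F,μ,1,β] where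
  toFun x := (x.fst, x.snd)
  invFun p := ⟨p.1, p.2⟩
  map_add' _ _ := rfl
  map_smul' _ _ := rfl
  left_inv _ := rfl
  right_inv _ := rfl

theorem finrank_eq_eight : Module.finrank F (CayleyDickson F μ β γ) = 8 := by
  rw [linearEquivProd.finrank_eq, Module.finrank_prod, QuaternionAlgebra.finrank_eq_four]

end CayleyDickson

/-! ### Norm, form and involution on `C`; alternativity -/

section

variable {F C : Type*} [Field F] [NonAssocRing C] [Module F C]

namespace CayleyDicksonStructure

variable (S : CayleyDicksonStructure F C)

theorem equiv_one : S.equiv 1 = 1 := by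
  have h := S.map_mul (S.equiv.symm 1) 1
  rwa [mul_one, S.equiv.apply_symm_apply, one_mul, eq_comm] at h

theorem equiv_conj (x : C) : S.equiv (S.conj x) = star (S.equiv x) := by
  rw [conj, map_sub, map_smul, equiv_one, trace, ← CayleyDickson.add_star_self]
  abel

theorem conj_mul_mul_self (x y : C) : S.conj x * (x * y) = S.norm x • y := by
  apply S.equiv.injective
  simp only [S.map_mul, equiv_conj, map_smul, norm, CayleyDickson.star_mul_mul_self]

theorem mul_self_mul_conj (x y : C) : y * x * S.conj x = S.norm x • y := by
  apply S.equiv.injective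
  simp only [S.map_mul, equiv_conj, map_smul, norm, CayleyDickson.mul_self_mul_star]

theorem norm_mul (x y : C) : S.norm (x * y) = S.norm x * S.norm y := by
  simp only [norm, S.map_mul, CayleyDickson.norm_mul]

theorem norm_smul (r : F) (x : C) : S.norm (r • x) = r ^ 2 * S.norm x := by
  simp only [norm, map_smul, CayleyDickson.norm_smul]

theorem norm_one : S.norm 1 = 1 := by
  rw [norm, equiv_one, CayleyDickson.norm_one]

theorem norm_zero : S.norm 0 = 0 := by
  simpa using S.norm_smul 0 0

theorem ne_zero_of_norm_ne_zero {x : C} (h : S.norm x ≠ 0) : x ≠ 0 := by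
  rintro rfl
  exact h S.norm_zero

theorem unit_ne_zero (S : CayleyDicksonStructure F C) : (1 : C) ≠ 0 :=
  S.ne_zero_of_norm_ne_zero (by rw [norm_one]; exact one_ne_zero)

/-- The form `f` as a bilinear form. -/
def bilinForm : LinearMap.BilinForm F C :=
  CayleyDickson.polar.compl₁₂ S.equiv.toLinearMap S.equiv.toLinearMap

theorem bilinForm_apply (x y : C) : S.bilinForm x y = S.form x y := by
  simp [bilinForm, CayleyDickson.polar_apply, form, norm]

theorem form_add_left (x y z : C) : S.form (x + y) z = S.form x z + S.form y z := by
  simp only [← bilinForm_apply, map_add, LinearMap.add_apply]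

theorem form_add_right (x y z : C) : S.form x (y + z) = S.form x y + S.form x z := by
  simp only [← bilinForm_apply, map_add]

theorem form_sub_left (x y z : C) : S.form (x - y) z = S.form x z - S.form y z := by
  simp only [← bilinForm_apply, map_sub, LinearMap.sub_apply]

theorem form_sub_right (x y z : C) : S.form x (y - z) = S.form x y - S.form x z := by
  simp only [← bilinForm_apply, map_sub]

theorem form_neg_left (x y : C) : S.form (-x) y = -S.form x y := by
  simp only [← bilinForm_apply, map_neg, LinearMap.neg_apply]

theorem form_smul_left (r : F) (x y : C) : S.form (r • x) y = r * S.form x y := by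
  simp only [← bilinForm_apply, map_smul, LinearMap.smul_apply, smul_eq_mul]

theorem form_smul_right (r : F) (x y : C) : S.form x (r • y) = r * S.form x y := by
  simp only [← bilinForm_apply, map_smul, smul_eq_mul]

theorem form_zero_left (x : C) : S.form 0 x = 0 := by
  simp only [← bilinForm_apply, map_zero, LinearMap.zero_apply]

theorem form_zero_right (x : C) : S.form x 0 = 0 := by
  simp only [← bilinForm_apply, map_zero]

theorem form_comm (x y : C) : S.form x y = S.form y x := by
  rw [form, form, add_comm x y]
  ring

theorem form_self (x : C) : S.form x x = 2 * S.norm x := by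
  rw [form, ← two_smul F x, norm_smul]
  ring

theorem norm_add (x y : C) : S.norm (x + y) = S.norm x + S.norm y + S.form x y := by
  rw [form]
  ring

theorem norm_neg (x : C) : S.norm (-x) = S.norm x := by
  rw [← neg_one_smul F x, norm_smul]
  ring

theorem form_one_right (x : C) : S.form x 1 = S.trace x := by
  rw [trace, ← CayleyDickson.polar_one, CayleyDickson.polar_apply, form, norm, norm, norm, map_add,
    equiv_one]

theorem eq_zero_of_form_eq_zero {x : C} (h : ∀ y, S.form x y = 0) : x = 0 := by
  apply S.equiv.map_eq_zero_iff.mp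
  refine CayleyDickson.eq_zero_of_polar_eq_zero S.four_mul_add_one_ne_zero S.β_ne_zero
    S.γ_ne_zero fun y => ?_
  have := h (S.equiv.symm y)
  rw [← bilinForm_apply] at this
  simpa [bilinForm] using this

theorem bilinForm_nondegenerate : S.bilinForm.Nondegenerate := by
  refine ⟨fun x h => ?_, fun x h => ?_⟩
  · exact S.eq_zero_of_form_eq_zero fun y => by rw [← bilinForm_apply]; exact h y
  · exact S.eq_zero_of_form_eq_zero fun y => by rw [form_comm, ← bilinForm_apply]; exact h y

theorem finrank_eq_eight (S : CayleyDicksonStructure F C) : Module.finrank F C = 8 := by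
  rw [S.equiv.finrank_eq, CayleyDickson.finrank_eq_eight]

theorem trace_add (x y : C) : S.trace (x + y) = S.trace x + S.trace y := by
  simp only [← form_one_right, form_add_left]

theorem trace_one : S.trace 1 = 2 := by
  rw [← form_one_right, form_self, norm_one, mul_one]

theorem conj_add (x y : C) : S.conj (x + y) = S.conj x + S.conj y := by
  simp only [conj, trace_add, add_smul]
  abel

theorem conj_eq_neg {x : C} (h : S.trace x = 0) : S.conj x = -x := by
  rw [conj, h, zero_smul, zero_sub]

theorem conj_zero : S.conj 0 = 0 := by
  rw [conj, sub_zero, ← form_one_right, form_zero_left, zero_smul]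

theorem trace_conj (x : C) : S.trace (S.conj x) = S.trace x := by
  rw [conj, ← form_one_right, form_sub_left, form_smul_left, form_one_right, form_one_right,
    trace_one]
  ring

theorem conj_conj (x : C) : S.conj (S.conj x) = x := by
  rw [conj, trace_conj, conj]
  abel

/-- The linearization of `x̄ (x z) = n(x) z`. -/
theorem conj_mul_mul_add (u w z : C) :
    S.conj u * (w * z) + S.conj w * (u * z) = S.form u w • z := by
  have h := S.conj_mul_mul_self (u + w) z
  rw [conj_add, norm_add, add_smul, add_smul, ← conj_mul_mul_self, ← conj_mul_mul_self] at h
  rw [← sub_eq_zero] at h ⊢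
  rw [← h]
  simp only [add_mul, mul_add]
  abel

/-- The linearization of `(z x) x̄ = n(x) z`. -/
theorem mul_mul_conj_add (u w z : C) :
    z * u * S.conj w + z * w * S.conj u = S.form u w • z := by
  have h := S.mul_self_mul_conj (u + w) z
  rw [conj_add, norm_add, add_smul, add_smul, ← mul_self_mul_conj, ← mul_self_mul_conj] at h
  rw [← sub_eq_zero] at h ⊢
  rw [← h]
  simp only [add_mul, mul_add]
  abel

theorem conj_mul_add (u w : C) : S.conj u * w + S.conj w * u = S.form u w • (1 : C) := by
  simpa using S.conj_mul_mul_add u w 1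

theorem mul_conj_add (u w : C) : u * S.conj w + w * S.conj u = S.form u w • (1 : C) := by
  simpa using S.mul_mul_conj_add u w 1

theorem conj_mul_self (x : C) : S.conj x * x = S.norm x • (1 : C) := by
  simpa using S.conj_mul_mul_self x 1

theorem mul_conj_self (x : C) : x * S.conj x = S.norm x • (1 : C) := by
  simpa using S.mul_self_mul_conj x 1

theorem norm_conj (x : C) : S.norm (S.conj x) = S.norm x := by
  rw [conj, sub_eq_add_neg, norm_add, norm_neg, norm_smul, norm_one, form_smul_left, form_comm,
    form_neg_left, form_one_right]
  ring

theorem form_mul_mul_left (x y z : C) : S.form (x * y) (x * z) = S.norm x * S.form y z := by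
  simp only [form, ← mul_add, norm_mul]
  ring

theorem form_mul_mul_right (x y z : C) : S.form (y * x) (z * x) = S.norm x * S.form y z := by
  simp only [form, ← add_mul, norm_mul]
  ring

theorem form_mul_mul_add_left (x w y z : C) :
    S.form (x * y) (w * z) + S.form (w * y) (x * z) = S.form x w * S.form y z := by
  have h := S.form_mul_mul_left (x + w) y z
  simp only [add_mul, form_add_left, form_add_right, norm_add, form_mul_mul_left] at h
  linear_combination h

theorem form_mul_mul_add_right (x w y z : C) :
    S.form (y * x) (z * w) + S.form (y * w) (z * x) = S.form x w * S.form y z := by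
  have h := S.form_mul_mul_right (x + w) y z
  simp only [mul_add, form_add_left, form_add_right, norm_add, form_mul_mul_right] at h
  linear_combination h

theorem eq_zero_of_mul_eq_zero {x y : C} (hx : S.norm x ≠ 0) (h : x * y = 0) : y = 0 := by
  have := S.conj_mul_mul_self x y
  rw [h, mul_zero, eq_comm, smul_eq_zero] at this
  exact this.resolve_left hx

theorem eq_zero_of_mul_eq_zero' {x y : C} (hy : S.norm y ≠ 0) (h : x * y = 0) : x = 0 := by
  have := S.mul_self_mul_conj y x
  rw [h, zero_mul, eq_comm, smul_eq_zero] at this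
  exact this.resolve_left hy

variable [IsScalarTower F C C] [SMulCommClass F C C]

/-- Polarizing `n(xy) = n(x)n(y)` against 1 in the first factor: left multiplication by `x` has
adjoint left multiplication by `x̄`. -/
theorem form_mul_left (x y z : C) : S.form (x * y) z = S.form y (S.conj x * z) := by
  have h := S.form_mul_mul_add_left x 1 y z
  rw [one_mul, one_mul, form_one_right] at h
  rw [conj, sub_mul, form_sub_right, smul_mul_assoc, one_mul, form_smul_right]
  linear_combination h

theorem form_mul_right (x y z : C) : S.form (y * x) z = S.form y (z * S.conj x) := by
  have h := S.form_mul_mul_add_right x 1 y z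
  rw [mul_one, mul_one, form_one_right] at h
  rw [conj, mul_sub, form_sub_right, mul_smul_comm, mul_one, form_smul_right]
  linear_combination h

/-- Linearizing the norm gives `xy + ȳx̄ = f(x̄, y)1`, and by adjointness `f(x̄, y) = t(xy)`. -/
theorem conj_mul (x y : C) : S.conj (x * y) = S.conj y * S.conj x := by
  have h := S.conj_mul_add (S.conj x) y
  rw [conj_conj, form_comm, ← mul_one (S.conj x), ← form_mul_left, form_one_right, mul_one] at h
  rw [conj, ← h]
  abel

theorem mul_self (x : C) : x * x = S.trace x • x - S.norm x • (1 : C) := by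
  rw [← mul_conj_self, conj, mul_sub, mul_smul_comm, mul_one]
  abel

theorem mul_add_mul (x y : C) :
    x * y + y * x = S.trace x • y + S.trace y • x - S.form x y • (1 : C) := by
  have h := S.mul_conj_add x y
  simp only [conj, mul_sub, mul_smul_comm, mul_one] at h
  rw [← h]
  abel

theorem mul_mul_self_left (S : CayleyDicksonStructure F C) (x y : C) : x * (x * y) = x * x * y := by
  have h := S.conj_mul_mul_self x y
  rw [conj, sub_mul, smul_mul_assoc, one_mul] at h
  rw [S.mul_self, sub_mul, smul_mul_assoc, smul_mul_assoc, one_mul, ← h]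
  abel

theorem mul_mul_self_right (S : CayleyDicksonStructure F C) (x y : C) :
    y * x * x = y * (x * x) := by
  have h := S.mul_self_mul_conj x y
  rw [conj, mul_sub, mul_smul_comm, mul_one] at h
  rw [S.mul_self, mul_sub, mul_smul_comm, mul_smul_comm, mul_one, ← h]
  abel

theorem isInvertibleElement_iff (x : C) : IsInvertibleElement x ↔ S.norm x ≠ 0 := by
  constructor
  · rintro ⟨y, h, -⟩ h0
    have := S.norm_mul x y
    rw [h, norm_one, h0, zero_mul] at this
    exact one_ne_zero this
  · intro h
    refine ⟨(S.norm x)⁻¹ • S.conj x, ?_, ?_⟩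
    · rw [mul_smul_comm, mul_conj_self, smul_smul, inv_mul_cancel₀ h, one_smul]
    · rw [smul_mul_assoc, conj_mul_self, smul_smul, inv_mul_cancel₀ h, one_smul]

end CayleyDicksonStructure

end

/-! ### Associativity of 4-dimensional anisotropic subalgebras -/

section

variable {F C : Type*} [Field F] [NonAssocRing C] [Module F C]
variable [IsScalarTower F C C] [SMulCommClass F C C]

theorem associator_eq_zero_of_mem_span {s : Set C}
    (h : ∀ x ∈ s, ∀ y ∈ s, ∀ z ∈ s, associator x y z = 0) {x y z : C}
    (hx : x ∈ Submodule.span F s) (hy : y ∈ Submodule.span F s) (hz : z ∈ Submodule.span F s) :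
    associator x y z = 0 := by
  simp only [associator_apply, sub_eq_zero] at h ⊢
  induction hx using Submodule.span_induction with
  | zero => simp
  | add x x' _ _ h₁ h₂ => rw [add_mul, add_mul, add_mul, h₁, h₂]
  | smul r x _ h₁ => rw [smul_mul_assoc, smul_mul_assoc, smul_mul_assoc, h₁]
  | mem x hx =>
    induction hy using Submodule.span_induction with
    | zero => simp
    | add y y' _ _ h₁ h₂ => rw [mul_add, add_mul, add_mul, mul_add, h₁, h₂]
    | smul r y _ h₁ => rw [mul_smul_comm, smul_mul_assoc, smul_mul_assoc, mul_smul_comm, h₁]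
    | mem y hy =>
      induction hz using Submodule.span_induction with
      | zero => simp
      | add z z' _ _ h₁ h₂ => rw [mul_add, mul_add, mul_add, h₁, h₂]
      | smul r z _ h₁ => rw [mul_smul_comm, mul_smul_comm, mul_smul_comm, h₁]
      | mem z hz => exact h x hx y hy z hz

theorem NonUnitalSubalgebra.exists_mem_not_mem_span (B : NonUnitalSubalgebra F C) (s : Finset C)
    (h : s.card < Module.finrank F B) : ∃ b ∈ B, b ∉ Submodule.span F (s : Set C) := by
  by_contra! hB
  have h₁ : Module.finrank F B.toSubmodule ≤ Module.finrank F (Submodule.span F (s : Set C)) :=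
    Submodule.finrank_mono hB
  exact absurd (h₁.trans (finrank_span_finset_le_card s)) (not_le.mpr h)

namespace CayleyDicksonStructure

variable (S : CayleyDicksonStructure F C)

theorem finiteDimensional (S : CayleyDicksonStructure F C) : FiniteDimensional F C :=
  FiniteDimensional.of_finrank_pos (by rw [S.finrank_eq_eight]; norm_num)

theorem associator_self_left (S : CayleyDicksonStructure F C) (x y : C) :
    associator x x y = 0 := by
  rw [associator_apply, S.mul_mul_self_left, sub_self]

theorem associator_self_right (S : CayleyDicksonStructure F C) (x y : C) :
    associator x y y = 0 := by
  rw [associator_apply, S.mul_mul_self_right, sub_self]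

theorem associator_swap_left (S : CayleyDicksonStructure F C) (x y z : C) :
    associator x y z = -associator y x z := by
  have h := S.associator_self_left (x + y) z
  have h₁ := S.associator_self_left x z
  have h₂ := S.associator_self_left y z
  simp only [associator_apply, add_mul, mul_add] at h h₁ h₂ ⊢
  linear_combination (norm := module) h - h₁ - h₂

theorem associator_swap_right (S : CayleyDicksonStructure F C) (x y z : C) :
    associator x y z = -associator x z y := by
  have h := S.associator_self_right x (y + z)
  have h₁ := S.associator_self_right x y
  have h₂ := S.associator_self_right x z
  simp only [associator_apply, add_mul, mul_add] at h h₁ h₂ ⊢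
  linear_combination (norm := module) h - h₁ - h₂

/-- Both bracketings collapse to `x²y²` by the two alternative laws. -/
theorem associator_self_mul (S : CayleyDicksonStructure F C) (x y : C) :
    associator x (x * y) y = 0 := by
  rw [associator_apply, S.mul_mul_self_left, S.mul_mul_self_right, S.mul_mul_self_right,
    S.mul_mul_self_left, sub_self]

/-- The fragment of Artin's theorem that is needed. The associator is trilinear and alternating and
kills 1, so only the triple `a, av, v` is not immediate, and `associator_self_mul` covers it. -/
theorem associator_eq_zero_of_mem_span_one_mul (S : CayleyDicksonStructure F C) {a v x y z : C}
    (hx : x ∈ Submodule.span F {1, a, v, a * v}) (hy : y ∈ Submodule.span F {1, a, v, a * v})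
    (hz : z ∈ Submodule.span F {1, a, v, a * v}) : associator x y z = 0 := by
  have o₁ : ∀ x y : C, associator 1 x y = 0 := fun x y => by simp [associator_apply]
  have o₂ : ∀ x y : C, associator x 1 y = 0 := fun x y => by simp [associator_apply]
  have o₃ : ∀ x y : C, associator x y 1 = 0 := fun x y => by simp [associator_apply]
  have m : ∀ x y : C, associator x y x = 0 := fun x y => by
    rw [S.associator_swap_right, S.associator_self_left, neg_zero]
  have h₁ : associator a (a * v) v = 0 := S.associator_self_mul a v
  have h₂ : associator a v (a * v) = 0 := by rw [S.associator_swap_right, h₁, neg_zero]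
  have h₃ : associator v a (a * v) = 0 := by rw [S.associator_swap_left, h₂, neg_zero]
  have h₄ : associator v (a * v) a = 0 := by rw [S.associator_swap_right, h₃, neg_zero]
  have h₅ : associator (a * v) a v = 0 := by rw [S.associator_swap_left, h₁, neg_zero]
  have h₆ : associator (a * v) v a = 0 := by rw [S.associator_swap_left, h₄, neg_zero]
  refine associator_eq_zero_of_mem_span ?_ hx hy hz
  rintro x (rfl | rfl | rfl | rfl) y (rfl | rfl | rfl | rfl) z (rfl | rfl | rfl | rfl) <;>
  first
  | apply o₁
  | apply o₂
  | apply o₃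
  | apply m
  | apply S.associator_self_left
  | apply S.associator_self_right
  | assumption

theorem mul_mem_span_one_self (S : CayleyDicksonStructure F C) {a x y : C}
    (hx : x ∈ Submodule.span F {1, a}) (hy : y ∈ Submodule.span F {1, a}) :
    x * y ∈ Submodule.span F {1, a} := by
  obtain ⟨p, q, rfl⟩ := Submodule.mem_span_pair.mp hx
  obtain ⟨r, s, rfl⟩ := Submodule.mem_span_pair.mp hy
  refine Submodule.mem_span_pair.mpr
    ⟨p * r - q * s * S.norm a, p * s + q * r + q * s * S.trace a, ?_⟩
  simp only [add_mul, mul_add, smul_mul_assoc, mul_smul_comm, S.mul_self, one_mul, mul_one]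
  module

theorem conj_mem_of_one_mem {P : Submodule F C} (h : 1 ∈ P) {x : C} (hx : x ∈ P) :
    S.conj x ∈ P :=
  P.sub_mem (P.smul_mem _ h) hx

/-- A four-dimensional subalgebra containing `1` on which the norm is anisotropic is spanned by
`1, a, v, av`. -/
theorem exists_le_span_of_anisotropic (B : NonUnitalSubalgebra F C) (one_mem : (1 : C) ∈ B)
    (aniso : ∀ b ∈ B, b ≠ 0 → S.norm b ≠ 0) (hB : Module.finrank F B = 4) :
    ∃ a v : C, ∀ b ∈ B, b ∈ Submodule.span F {1, a, v, a * v} := by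
  classical
  have := S.finiteDimensional
  obtain ⟨a, ha, ha'⟩ := B.exists_mem_not_mem_span {1} (by rw [hB]; simp)
  obtain ⟨v, hv, hv'⟩ := B.exists_mem_not_mem_span {1, a}
    (by rw [hB]; exact (Finset.card_le_two).trans_lt (by norm_num))
  rw [Finset.coe_singleton] at ha'
  rw [Finset.coe_insert, Finset.coe_singleton] at hv'
  have hlin : ∀ p q : F, p • (1 : C) + q • a = 0 → p = 0 ∧ q = 0 := by
    intro p q h
    have hq : q = 0 := by
      by_contra hq
      apply ha'
      have h₁ : a = (-(q⁻¹ * p)) • (1 : C) := by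
        rw [← sub_eq_zero, ← smul_zero q⁻¹, ← h, smul_add, smul_smul, smul_smul,
          inv_mul_cancel₀ hq]
        module
      rw [h₁]
      exact Submodule.smul_mem _ _ (Submodule.subset_span rfl)
    refine ⟨?_, hq⟩
    rw [hq, zero_smul, add_zero, smul_eq_zero] at h
    exact h.resolve_right S.unit_ne_zero
  have hind : LinearIndependent F ![1, a, v, a * v] := by
    rw [Fintype.linearIndependent_iff]
    intro g hg
    simp only [Fin.sum_univ_four, Matrix.cons_val] at hg
    -- With `c` the left coefficient of `v`, the relation puts `cv` in `F + Fa`; multiplying by `c̄`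
    -- puts `n(c)v` there, against the choice of `v` unless `c = 0`.
    have hc : g 2 • (1 : C) + g 3 • a = 0 := by
      by_contra hc
      set c := g 2 • (1 : C) + g 3 • a with hcdef
      have hcB : c ∈ B := B.add_mem (B.toSubmodule.smul_mem _ one_mem) (B.toSubmodule.smul_mem _ ha)
      have hn := aniso c hcB hc
      have h₁ : c * v = -(g 0 • (1 : C) + g 1 • a) := by
        rw [eq_neg_iff_add_eq_zero, ← hg, hcdef, add_mul, smul_mul_assoc, smul_mul_assoc, one_mul]
        abel
      have hspan : ∀ p q : F, p • (1 : C) + q • a ∈ Submodule.span F {1, a} := fun p q =>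
        Submodule.mem_span_pair.mpr ⟨p, q, rfl⟩
      have h₂ : S.norm c • v ∈ Submodule.span F {1, a} := by
        rw [← S.conj_mul_mul_self, h₁]
        exact S.mul_mem_span_one_self
          (S.conj_mem_of_one_mem (Submodule.subset_span (by simp)) (hspan _ _))
          (Submodule.neg_mem _ (hspan _ _))
      exact hv' ((Submodule.smul_mem_iff _ hn).mp h₂)
    have h₀ : g 0 • (1 : C) + g 1 • a = 0 := by
      have h₁ : (g 2 • (1 : C) + g 3 • a) * v = 0 := by rw [hc, zero_mul]
      rw [add_mul, smul_mul_assoc, smul_mul_assoc, one_mul] at h₁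
      rw [← hg, add_assoc (_ + _), h₁, add_zero]
    obtain ⟨h2, h3⟩ := hlin _ _ hc
    obtain ⟨h0, h1⟩ := hlin _ _ h₀
    intro i
    fin_cases i <;> assumption
  refine ⟨a, v, ?_⟩
  have hrange : Set.range ![1, a, v, a * v] = {1, a, v, a * v} := by
    simp only [Matrix.range_cons, Matrix.range_empty, Set.union_empty, Set.singleton_union]
  have hle : Submodule.span F {1, a, v, a * v} ≤ B.toSubmodule := by
    rw [Submodule.span_le]
    rintro _ (rfl | rfl | rfl | rfl)
    exacts [one_mem, ha, hv, B.mul_mem ha hv]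
  have heq : Submodule.span F {1, a, v, a * v} = B.toSubmodule := by
    refine Submodule.eq_of_le_of_finrank_eq hle ?_
    rw [← hrange, finrank_span_eq_card hind, Fintype.card_fin]
    exact hB.symm
  intro b hb
  rw [heq]
  exact hb

/-- A four-dimensional subalgebra containing `1` on which the norm is anisotropic is an
associative division algebra. -/
theorem isAssociativeDivisionSubalgebra_of_anisotropic (B : NonUnitalSubalgebra F C)
    (one_mem : (1 : C) ∈ B) (aniso : ∀ b ∈ B, b ≠ 0 → S.norm b ≠ 0)
    (hB : Module.finrank F B = 4) : IsAssociativeDivisionSubalgebra B := by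
  refine ⟨one_mem, ?_, ?_⟩
  · obtain ⟨a, v, h⟩ := S.exists_le_span_of_anisotropic B one_mem aniso hB
    intro x hx y hy z hz
    exact sub_eq_zero.mp
      (S.associator_eq_zero_of_mem_span_one_mul (h x hx) (h y hy) (h z hz))
  · intro x hx hx0
    have hn := aniso x hx hx0
    refine ⟨(S.norm x)⁻¹ • S.conj x,
      B.toSubmodule.smul_mem _ (S.conj_mem_of_one_mem (P := B.toSubmodule) one_mem hx), ?_, ?_⟩
    · rw [mul_smul_comm, mul_conj_self, smul_smul, inv_mul_cancel₀ hn, one_smul]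
    · rw [smul_mul_assoc, conj_mul_self, smul_smul, inv_mul_cancel₀ hn, one_smul]

theorem norm_ne_zero_of_mem {B : NonUnitalSubalgebra F C} (hB : IsAssociativeDivisionSubalgebra B)
    {b : C} (hb : b ∈ B) (h : b ≠ 0) : S.norm b ≠ 0 := by
  obtain ⟨c, -, h₁, h₂⟩ := hB.exists_inv b hb h
  exact (S.isInvertibleElement_iff b).mp ⟨c, h₁, h₂⟩

end CayleyDicksonStructure

/-! ### Decompositions `C = B ⊕ wB` -/

/-- The linear map `(a, b) ↦ a + w b`. -/
def NonUnitalSubalgebra.addMulLinearMap (B : NonUnitalSubalgebra F C) (w : C) : B × B →ₗ[F] C where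
  toFun p := (p.1 : C) + w * (p.2 : C)
  map_add' p q := by
    simp only [Prod.fst_add, Prod.snd_add, NonUnitalSubalgebra.coe_add, mul_add]
    abel
  map_smul' r p := by
    simp only [Prod.smul_fst, Prod.smul_snd, NonUnitalSubalgebra.coe_smul, mul_smul_comm, smul_add,
      RingHom.id_apply]

namespace IsDirectSumWith

variable {B : NonUnitalSubalgebra F C} {w : C}

theorem exists_eq (h : IsDirectSumWith B w) (y : C) : ∃ a ∈ B, ∃ b ∈ B, y = a + w * b := by
  obtain ⟨⟨a, b⟩, hy⟩ := h.2 y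
  exact ⟨a, a.2, b, b.2, hy.symm⟩

theorem eq_and_eq (h : IsDirectSumWith B w) {a b a' b' : C} (ha : a ∈ B) (hb : b ∈ B)
    (ha' : a' ∈ B) (hb' : b' ∈ B) (heq : a + w * b = a' + w * b') : a = a' ∧ b = b' := by
  have := @h.1 (⟨a, ha⟩, ⟨b, hb⟩) (⟨a', ha'⟩, ⟨b', hb'⟩) heq
  simpa using this

theorem exists_linearMap (h : IsDirectSumWith B w) (g : C →ₗ[F] C) :
    ∃ d : C →ₗ[F] C, ∀ a ∈ B, ∀ b ∈ B, d (a + w * b) = g b := by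
  let e : (B × B) ≃ₗ[F] C := LinearEquiv.ofBijective (B.addMulLinearMap w) h
  refine ⟨g ∘ₗ B.toSubmodule.subtype ∘ₗ LinearMap.snd F B B ∘ₗ e.symm.toLinearMap, ?_⟩
  intro a ha b hb
  have he : e (⟨a, ha⟩, ⟨b, hb⟩) = a + w * b := rfl
  rw [← he]
  simp

end IsDirectSumWith

namespace CayleyDicksonStructure

variable (S : CayleyDicksonStructure F C)

theorem isDirectSumWith_of_forall_eq_zero (S : CayleyDicksonStructure F C)
    {B : NonUnitalSubalgebra F C} {w : C} (hB : Module.finrank F B = 4)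
    (h : ∀ a ∈ B, ∀ b ∈ B, a + w * b = 0 → a = 0 ∧ b = 0) : IsDirectSumWith B w := by
  have := S.finiteDimensional
  have : FiniteDimensional F B := inferInstanceAs (FiniteDimensional F B.toSubmodule)
  have hinj : Function.Injective (B.addMulLinearMap w) := by
    rw [← LinearMap.ker_eq_bot, LinearMap.ker_eq_bot']
    rintro ⟨a, b⟩ hab
    obtain ⟨ha, hb⟩ := h a a.2 b b.2 hab
    exact Prod.ext (Subtype.ext ha) (Subtype.ext hb)
  refine ⟨hinj, ?_⟩
  exact (LinearMap.injective_iff_surjective_of_finrank_eq_finrank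
    (by rw [Module.finrank_prod, hB, S.finrank_eq_eight])).mp hinj

/-! ### The doubling rules for a vector orthogonal to `B` -/

section Orthogonal

variable {B : NonUnitalSubalgebra F C} {v : C}

theorem conj_mem (one_mem : (1 : C) ∈ B) {a : C} (ha : a ∈ B) : S.conj a ∈ B :=
  S.conj_mem_of_one_mem (P := B.toSubmodule) one_mem ha

theorem conj_eq_neg_of_orthogonal (one_mem : (1 : C) ∈ B) (hv : v ∈ S.orthogonal B) :
    S.conj v = -v :=
  S.conj_eq_neg (by rw [← form_one_right]; exact hv 1 one_mem)

theorem mul_mem_orthogonal (one_mem : (1 : C) ∈ B) (hv : v ∈ S.orthogonal B) {b : C}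
    (hb : b ∈ B) : v * b ∈ S.orthogonal B := by
  intro c hc
  rw [form_mul_right]
  exact hv _ (B.mul_mem hc (S.conj_mem one_mem hb))

theorem mul_self_of_orthogonal (one_mem : (1 : C) ∈ B) (hv : v ∈ S.orthogonal B) :
    v * v = -S.norm v • (1 : C) := by
  rw [neg_smul, ← mul_conj_self, S.conj_eq_neg_of_orthogonal one_mem hv, mul_neg, neg_neg]

/-- Orthogonality kills the right-hand side of the linearized identity `x̄(xz) = n(x)z` at `ā, v`,
and `v̄ = -v`. -/
theorem mul_orthogonal_mul (one_mem : (1 : C) ∈ B) (hv : v ∈ S.orthogonal B) {a : C}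
    (ha : a ∈ B) (b : C) : a * (v * b) = v * (S.conj a * b) := by
  have h := S.conj_mul_mul_add (S.conj a) v b
  rw [conj_conj, S.conj_eq_neg_of_orthogonal one_mem hv, form_comm, hv _ (S.conj_mem one_mem ha),
    zero_smul, neg_mul] at h
  rwa [← sub_eq_zero, sub_eq_add_neg]

/-- Since `vb` is orthogonal to 1 as well, `-vb` is its conjugate `b̄v̄ = -b̄v`. -/
theorem orthogonal_mul_eq (one_mem : (1 : C) ∈ B) (hv : v ∈ S.orthogonal B) {b : C}
    (hb : b ∈ B) : v * b = S.conj b * v := by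
  have h := S.conj_eq_neg_of_orthogonal one_mem (S.mul_mem_orthogonal one_mem hv hb)
  rw [conj_mul, S.conj_eq_neg_of_orthogonal one_mem hv, mul_neg, neg_inj] at h
  exact h.symm

theorem orthogonal_mul_mul (one_mem : (1 : C) ∈ B) (hv : v ∈ S.orthogonal B) {a b : C}
    (ha : a ∈ B) (hb : b ∈ B) : v * b * a = v * (a * b) := by
  have h := S.mul_mul_conj_add v (S.conj a) (S.conj b)
  rw [conj_conj, S.conj_eq_neg_of_orthogonal one_mem hv, hv _ (S.conj_mem one_mem ha),
    zero_smul, mul_neg, ← conj_mul, ← S.orthogonal_mul_eq one_mem hv hb,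
    ← S.orthogonal_mul_eq one_mem hv (B.mul_mem ha hb)] at h
  rwa [← sub_eq_zero, sub_eq_add_neg]

theorem orthogonal_mul_mul_orthogonal_mul (one_mem : (1 : C) ∈ B) (hv : v ∈ S.orthogonal B)
    {b c : C} (hb : b ∈ B) (hc : c ∈ B) :
    v * b * (v * c) = -S.norm v • (c * S.conj b) := by
  have h := S.conj_mul_mul_add (v * b) v c
  have h₁ : S.form (v * b) v = S.norm v * S.trace b := by
    have := S.form_mul_mul_left v b 1
    rwa [mul_one, form_one_right] at this
  rw [S.conj_eq_neg_of_orthogonal one_mem (S.mul_mem_orthogonal one_mem hv hb),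
    S.orthogonal_mul_mul one_mem hv hc hb, conj_mul_mul_self, h₁] at h
  rw [conj, mul_sub, mul_smul_comm, mul_one]
  rw [neg_mul, neg_add_eq_iff_eq_add] at h
  linear_combination (norm := module) -h

theorem add_mul_add_of_orthogonal (one_mem : (1 : C) ∈ B) (hv : v ∈ S.orthogonal B)
    {a₁ b₁ a₂ b₂ : C} (ha₁ : a₁ ∈ B) (hb₁ : b₁ ∈ B) (ha₂ : a₂ ∈ B) (hb₂ : b₂ ∈ B) :
    (a₁ + v * b₁) * (a₂ + v * b₂) =
      (a₁ * a₂ + -S.norm v • (b₂ * S.conj b₁)) + v * (S.conj a₁ * b₂ + a₂ * b₁) := by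
  rw [add_mul, mul_add, mul_add, S.mul_orthogonal_mul one_mem hv ha₁,
    S.orthogonal_mul_mul one_mem hv ha₂ hb₁,
    S.orthogonal_mul_mul_orthogonal_mul one_mem hv hb₁ hb₂, mul_add]
  abel

/-- A nondegenerate four-dimensional division subalgebra and an anisotropic vector orthogonal to it
satisfy condition (I). -/
theorem isDoubleOfDivisionSubalgebra_of_orthogonal (hdiv : IsAssociativeDivisionSubalgebra B)
    (hB : Module.finrank F B = 4) (hrad : ∀ a ∈ B, a ∈ S.orthogonal B → a = 0)
    (hv : v ∈ S.orthogonal B) (hn : S.norm v ≠ 0) :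
    IsDoubleOfDivisionSubalgebra S B v (-S.norm v) where
  division := hdiv
  finrank_eq := hB
  γ_ne_zero := neg_ne_zero.mpr hn
  mul_self := S.mul_self_of_orthogonal hdiv.one_mem hv
  directSum := by
    refine S.isDirectSumWith_of_forall_eq_zero hB fun a ha b hb hab => ?_
    -- Here `a = -vb` lies in both `B` and `B^⊥`.
    have ha0 : a = 0 := by
      refine hrad a ha fun c hc => ?_
      rw [eq_neg_of_add_eq_zero_left hab, form_neg_left,
        S.mul_mem_orthogonal hdiv.one_mem hv hb c hc, neg_zero]
    rw [ha0, zero_add] at hab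
    exact ⟨ha0, S.eq_zero_of_mul_eq_zero hn hab⟩
  mul_eq _ ha₁ _ hb₁ _ ha₂ _ hb₂ :=
    S.add_mul_add_of_orthogonal hdiv.one_mem hv ha₁ hb₁ ha₂ hb₂

end Orthogonal

end CayleyDicksonStructure

/-! ### Case (I): derivations of a doubled division algebra -/

namespace IsDoubleOfDivisionSubalgebra

variable {S : CayleyDicksonStructure F C} {B : NonUnitalSubalgebra F C} {v : C} {γ : F}

theorem not_mem (h : IsDoubleOfDivisionSubalgebra S B v γ) : v ∉ B := by
  intro hv
  have h1 := h.division.one_mem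
  exact S.unit_ne_zero (h.directSum.eq_and_eq hv B.zero_mem B.zero_mem h1 (by simp)).2.symm

theorem trace_eq_zero (h : IsDoubleOfDivisionSubalgebra S B v γ) : S.trace v = 0 := by
  by_contra ht
  apply h.not_mem
  have h₁ : S.trace v • v = (γ + S.norm v) • (1 : C) := by
    rw [add_smul, ← h.mul_self, S.mul_self]
    abel
  have h₂ : S.trace v • v ∈ B.toSubmodule := by
    rw [h₁]
    exact B.toSubmodule.smul_mem _ h.division.one_mem
  exact (Submodule.smul_mem_iff _ ht).mp h₂

theorem norm_eq (h : IsDoubleOfDivisionSubalgebra S B v γ) : S.norm v • (1 : C) = -γ • (1 : C) := by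
  rw [neg_smul, ← h.mul_self, S.mul_self, h.trace_eq_zero, zero_smul, zero_sub, neg_neg]

theorem norm_ne_zero (h : IsDoubleOfDivisionSubalgebra S B v γ) : S.norm v ≠ 0 := by
  intro h0
  have h₁ := h.norm_eq
  rw [h0, zero_smul, eq_comm, smul_eq_zero, neg_eq_zero] at h₁
  exact h.γ_ne_zero (h₁.resolve_right S.unit_ne_zero)

/-- The multiplication rule contains `av = vā`, while `f(a, v)1 = av̄ + vā` and `v̄ = -v`. -/
theorem mem_orthogonal (h : IsDoubleOfDivisionSubalgebra S B v γ) : v ∈ S.orthogonal B := by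
  intro a ha
  have h1 := h.division.one_mem
  have h₁ := h.mul_eq a ha 0 B.zero_mem 0 B.zero_mem 1 h1
  simp only [S.conj_zero, mul_zero, add_zero, zero_add, mul_one, smul_zero] at h₁
  have h₂ := S.mul_conj_add a v
  rw [S.conj_eq_neg h.trace_eq_zero, mul_neg, h₁, neg_add_cancel, eq_comm, smul_eq_zero] at h₂
  rw [S.form_comm]
  exact h₂.resolve_right S.unit_ne_zero

/-- The derivation `a + v b ↦ v (b u)`. -/
theorem exists_derivation (h : IsDoubleOfDivisionSubalgebra S B v γ) {u : C} (hu : u ∈ B)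
    (hu0 : u ≠ 0) (htu : S.trace u = 0) :
    ∃ d : C →ₗ[F] C, IsDerivationWithInvertibleValues d ∧ (B : Set C) = {y | d y = 0} ∧
      ∀ a ∈ B, ∀ b ∈ B, d (a + v * b) = v * (b * u) := by
  obtain ⟨d, hd⟩ :=
    h.directSum.exists_linearMap (LinearMap.mulLeft F v ∘ₗ LinearMap.mulRight F u)
  replace hd : ∀ a ∈ B, ∀ b ∈ B, d (a + v * b) = v * (b * u) := hd
  have h1 := h.division.one_mem
  have hn : ∀ b ∈ B, b ≠ 0 → S.norm (v * (b * u)) ≠ 0 := by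
    intro b hb hb0
    rw [S.norm_mul, S.norm_mul]
    exact mul_ne_zero h.norm_ne_zero (mul_ne_zero (S.norm_ne_zero_of_mem h.division hb hb0)
      (S.norm_ne_zero_of_mem h.division hu hu0))
  refine ⟨d, ⟨?_, ?_, ?_⟩, ?_, hd⟩
  · intro x y
    obtain ⟨a₁, ha₁, b₁, hb₁, rfl⟩ := h.directSum.exists_eq x
    obtain ⟨a₂, ha₂, b₂, hb₂, rfl⟩ := h.directSum.exists_eq y
    have hb₁' := S.conj_mem h1 hb₁
    have ha₁' := S.conj_mem h1 ha₁
    have e₁ := h.mul_eq 0 B.zero_mem (b₁ * u) (B.mul_mem hb₁ hu) a₂ ha₂ b₂ hb₂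
    have e₂ := h.mul_eq a₁ ha₁ b₁ hb₁ 0 B.zero_mem (b₂ * u) (B.mul_mem hb₂ hu)
    rw [zero_add] at e₁ e₂
    -- The `B`-components `γ b₂ū b̄₁` and `γ b₂u b̄₁` cancel because `ū = -u`; this is where `t(u) =
    -- 0` enters.
    rw [h.mul_eq a₁ ha₁ b₁ hb₁ a₂ ha₂ b₂ hb₂, hd a₁ ha₁ b₁ hb₁, hd a₂ ha₂ b₂ hb₂,
      hd _ (B.add_mem (B.mul_mem ha₁ ha₂) (B.toSubmodule.smul_mem _ (B.mul_mem hb₂ hb₁'))) _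
        (B.add_mem (B.mul_mem ha₁' hb₂) (B.mul_mem ha₂ hb₁)), e₁, e₂, S.conj_mul,
      S.conj_eq_neg htu, S.conj_zero,
      add_mul, h.division.mul_assoc _ ha₁' _ hb₂ _ hu, h.division.mul_assoc _ ha₂ _ hb₁ _ hu,
      h.division.mul_assoc _ hb₂ _ hu _ hb₁']
    simp only [zero_mul, mul_zero, zero_add, add_zero, neg_mul, mul_neg, smul_neg,
      mul_add]
    abel
  · rintro rfl
    have := hd 0 B.zero_mem 1 h1
    exact S.ne_zero_of_norm_ne_zero (hn 1 h1 S.unit_ne_zero) this.symm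
  · intro x
    obtain ⟨a, ha, b, hb, rfl⟩ := h.directSum.exists_eq x
    rw [hd a ha b hb, S.isInvertibleElement_iff]
    by_cases hb0 : b = 0
    · left
      rw [hb0, zero_mul, mul_zero]
    · exact Or.inr (hn b hb hb0)
  · ext x
    constructor
    · intro hx
      have := hd x hx 0 B.zero_mem
      simpa using this
    · intro hx
      obtain ⟨a, ha, b, hb, rfl⟩ := h.directSum.exists_eq x
      change d (a + v * b) = 0 at hx
      rw [hd a ha b hb] at hx
      have hb0 : b = 0 := by
        by_contra hb0
        exact S.ne_zero_of_norm_ne_zero (hn b hb hb0) hx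
      rw [hb0, mul_zero, add_zero]
      exact ha

/-- The trace is a linear functional on a space of dimension 4, so its kernel is nonzero. -/
theorem exists_trace_eq_zero (h : IsDoubleOfDivisionSubalgebra S B v γ) :
    ∃ u ∈ B, u ≠ 0 ∧ S.trace u = 0 := by
  have := S.finiteDimensional
  have : FiniteDimensional F B := inferInstanceAs (FiniteDimensional F B.toSubmodule)
  let t : B →ₗ[F] F := S.bilinForm.flip 1 ∘ₗ B.toSubmodule.subtype
  obtain ⟨u, hu, hu0⟩ := (Submodule.ne_bot_iff _).mp
    (LinearMap.ker_ne_bot_of_finrank_lt (f := t) (by rw [h.finrank_eq, Module.finrank_self]; simp))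
  refine ⟨u, u.2, fun h0 => hu0 (Subtype.ext h0), ?_⟩
  rw [← S.form_one_right, ← S.bilinForm_apply]
  exact hu

end IsDoubleOfDivisionSubalgebra

/-! ### Case (II): self-orthogonal subfields in characteristic 2 -/

namespace IsSumOverSelfOrthogonalSubfield

variable {S : CayleyDicksonStructure F C} {B : NonUnitalSubalgebra F C} {x : C}

theorem form_eq_zero (h : IsSumOverSelfOrthogonalSubfield S B x) {a b : C} (ha : a ∈ B)
    (hb : b ∈ B) : S.form a b = 0 := by
  have : a ∈ S.orthogonal B := h.self_orthogonal ▸ ha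
  exact this b hb

/-- Since 1 is orthogonal to itself, `2 = t(1) = f(1, 1) = 0`. -/
theorem charP_two (h : IsSumOverSelfOrthogonalSubfield S B x) : CharP F 2 := by
  have h1 := h.subfield.one_mem
  have h2 : (2 : F) = 0 := by
    rw [← S.trace_one, ← S.form_one_right, h.form_eq_zero h1 h1]
  exact CharTwo.of_one_ne_zero_of_two_eq_zero one_ne_zero h2

theorem add_self_eq_zero (h : IsSumOverSelfOrthogonalSubfield S B x) (y : C) : y + y = 0 := by
  have := h.charP_two
  rw [← two_smul F, CharTwo.two_eq_zero, zero_smul]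

theorem neg_eq_self (h : IsSumOverSelfOrthogonalSubfield S B x) (y : C) : -y = y :=
  neg_eq_of_add_eq_zero_left (h.add_self_eq_zero y)

theorem conj_eq_self (h : IsSumOverSelfOrthogonalSubfield S B x) {a : C} (ha : a ∈ B) :
    S.conj a = a := by
  rw [S.conj_eq_neg, h.neg_eq_self]
  rw [← S.form_one_right, h.form_eq_zero ha h.subfield.one_mem]

theorem conj_generator (h : IsSumOverSelfOrthogonalSubfield S B x) : S.conj x = x := by
  rw [S.conj_eq_neg h.trace_eq_zero, h.neg_eq_self]

/-- Same linearized identity as in the doubling rules, but `x` need not be orthogonal to `B`, so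
`f(x, a)` survives as a correction term. -/
theorem mul_generator_mul (h : IsSumOverSelfOrthogonalSubfield S B x) {a : C} (ha : a ∈ B)
    (b : C) : a * (x * b) = x * (a * b) + S.form x a • b := by
  have e := S.conj_mul_mul_add x a b
  rw [h.conj_eq_self ha, h.conj_generator] at e
  rw [← e, ← add_assoc, h.add_self_eq_zero, zero_add]

theorem mul_generator (h : IsSumOverSelfOrthogonalSubfield S B x) {a : C} (ha : a ∈ B) :
    a * x = x * a + S.form x a • (1 : C) := by
  simpa using h.mul_generator_mul ha 1

theorem generator_mul_mul (h : IsSumOverSelfOrthogonalSubfield S B x) {a b : C} (ha : a ∈ B)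
    (hb : b ∈ B) : x * b * a =
      x * (b * a) + S.form x (b * a) • (1 : C) + S.form x a • b + S.form x b • a := by
  have e := S.mul_mul_conj_add x a b
  rw [h.conj_eq_self ha, h.conj_generator, h.mul_generator hb, h.mul_generator (B.mul_mem hb ha),
    add_mul, smul_mul_assoc, one_mul] at e
  rw [← e, ← sub_eq_zero, ← h.add_self_eq_zero
    (-(x * (b * a) + S.form x (b * a) • (1 : C) + S.form x b • a))]
  abel

theorem generator_mul_mul_generator_mul (h : IsSumOverSelfOrthogonalSubfield S B x) {b c : C}
    (hb : b ∈ B) (hc : c ∈ B) : x * b * (x * c) =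
      S.norm x • (b * c) + S.form x (b * c) • x + S.form x c • (x * b) := by
  have e := S.conj_mul_mul_add (x * b) x c
  have e₁ : S.form (x * b) x = 0 := by
    have := S.form_mul_mul_left x b 1
    rwa [mul_one, h.form_eq_zero hb h.subfield.one_mem, mul_zero] at this
  have e₂ := S.conj_mul_mul_self x (b * c)
  rw [h.conj_generator] at e₂
  rw [e₁, zero_smul, S.conj_mul, h.conj_eq_self hb, h.conj_generator, h.mul_generator hb,
    h.generator_mul_mul hc hb, mul_add, mul_add, mul_add, e₂, add_mul] at e
  simp only [mul_smul_comm, smul_mul_assoc, one_mul, mul_one] at e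
  linear_combination (norm := module) e - h.add_self_eq_zero
    (S.norm x • (b * c) + S.form x (b * c) • x + S.form x c • (x * b) + S.form x b • (x * c))

/-- The derivation `a + x b ↦ b`. -/
theorem exists_derivation (h : IsSumOverSelfOrthogonalSubfield S B x) :
    ∃ d : C →ₗ[F] C, IsDerivationWithInvertibleValues d ∧ (B : Set C) = {y | d y = 0} ∧
      ∀ a ∈ B, ∀ b ∈ B, d (a + x * b) = b := by
  obtain ⟨d, hd⟩ := h.directSum.exists_linearMap LinearMap.id
  replace hd : ∀ a ∈ B, ∀ b ∈ B, d (a + x * b) = b := hd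
  have h1 := h.subfield.one_mem
  have smul_mem : ∀ (r : F), ∀ b ∈ B, r • b ∈ B := fun r b hb => B.toSubmodule.smul_mem r hb
  refine ⟨d, ⟨?_, ?_, ?_⟩, ?_, hd⟩
  · intro y z
    obtain ⟨a₁, ha₁, b₁, hb₁, rfl⟩ := h.directSum.exists_eq y
    obtain ⟨a₂, ha₂, b₂, hb₂, rfl⟩ := h.directSum.exists_eq z
    -- Normal form of the product; `d` reads off the coefficient of `x`.
    have e : (a₁ + x * b₁) * (a₂ + x * b₂) =
        (a₁ * a₂ + S.form x a₁ • b₂ + S.form x (b₁ * a₂) • (1 : C) + S.form x a₂ • b₁ +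
          S.form x b₁ • a₂ + S.norm x • (b₁ * b₂)) +
        x * (a₁ * b₂ + b₁ * a₂ + S.form x (b₁ * b₂) • (1 : C) + S.form x b₂ • b₁) := by
      rw [add_mul, mul_add, mul_add, h.mul_generator_mul ha₁, h.generator_mul_mul ha₂ hb₁,
        h.generator_mul_mul_generator_mul hb₁ hb₂]
      simp only [mul_add, mul_smul_comm, mul_one]
      abel
    -- The two sides of the Leibniz rule differ by twice `x(b₁b₂) + f(x, b₁)b₂`, which is 0 in
    -- characteristic 2.
    rw [e, hd _ ?_ _ ?_, hd _ ha₁ _ hb₁, hd _ ha₂ _ hb₂, mul_add, add_mul, h.mul_generator_mul hb₁,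
      h.generator_mul_mul hb₂ hb₁, ← sub_eq_zero,
      ← h.add_self_eq_zero (-(x * (b₁ * b₂) + S.form x b₁ • b₂))]
    · abel
    · exact B.add_mem (B.add_mem (B.add_mem (B.add_mem (B.add_mem (B.mul_mem ha₁ ha₂)
        (smul_mem _ _ hb₂)) (smul_mem _ _ h1)) (smul_mem _ _ hb₁)) (smul_mem _ _ ha₂))
        (smul_mem _ _ (B.mul_mem hb₁ hb₂))
    · exact B.add_mem (B.add_mem (B.add_mem (B.mul_mem ha₁ hb₂) (B.mul_mem hb₁ ha₂))
        (smul_mem _ _ h1)) (smul_mem _ _ hb₁)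
  · rintro rfl
    exact S.unit_ne_zero (hd 0 B.zero_mem 1 h1).symm
  · intro y
    obtain ⟨a, ha, b, hb, rfl⟩ := h.directSum.exists_eq y
    rw [hd a ha b hb, S.isInvertibleElement_iff]
    exact or_iff_not_imp_left.mpr
      (S.norm_ne_zero_of_mem h.subfield.toIsAssociativeDivisionSubalgebra hb)
  · ext y
    constructor
    · intro hy
      have := hd y hy 0 B.zero_mem
      simpa using this
    · intro hy
      obtain ⟨a, ha, b, hb, rfl⟩ := h.directSum.exists_eq y
      change d (a + x * b) = 0 at hy
      rw [hd a ha b hb] at hy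
      rw [hy, mul_zero, add_zero]
      exact ha

end IsSumOverSelfOrthogonalSubfield

/-! ### Dimension bounds from splitness -/

namespace CayleyDicksonStructure

variable (S : CayleyDicksonStructure F C)

/-- A split Cayley–Dickson algebra has a totally isotropic subspace of dimension four. -/
theorem exists_isotropic (hsplit : IsSplitAlgebra C) :
    ∃ P : Submodule F C, (∀ p ∈ P, S.norm p = 0) ∧ 4 ≤ Module.finrank F P := by
  have := S.finiteDimensional
  obtain ⟨x, y, hx, hy, hxy⟩ := hsplit
  have hn : S.norm x = 0 := by
    by_contra hn
    exact hy (S.eq_zero_of_mul_eq_zero hn hxy)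
  have h := LinearMap.finrank_range_add_finrank_ker (LinearMap.mulLeft F x)
  rw [S.finrank_eq_eight] at h
  -- The range and the kernel of left multiplication by the zero divisor `x` are both totally
  -- isotropic, and their dimensions add up to 8.
  by_cases h4 : 4 ≤ Module.finrank F (LinearMap.mulLeft F x).range
  · refine ⟨_, ?_, h4⟩
    rintro _ ⟨c, rfl⟩
    rw [LinearMap.mulLeft_apply, norm_mul, hn, zero_mul]
  · refine ⟨(LinearMap.mulLeft F x).ker, ?_, by omega⟩
    intro c hc
    by_contra hnc
    exact hx (S.eq_zero_of_mul_eq_zero' hnc hc)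

/-- In a split Cayley–Dickson algebra, anisotropic subspaces have dimension at most four. -/
theorem finrank_le_four_of_anisotropic (hsplit : IsSplitAlgebra C) (Q : Submodule F C)
    (hQ : ∀ q ∈ Q, q ≠ 0 → S.norm q ≠ 0) : Module.finrank F Q ≤ 4 := by
  have := S.finiteDimensional
  obtain ⟨P, hP, h4⟩ := S.exists_isotropic hsplit
  have hdisj : Disjoint P Q := by
    rw [Submodule.disjoint_def]
    intro z hzP hzQ
    by_contra hz
    exact hQ z hzQ hz (hP z hzP)
  have := Submodule.finrank_add_finrank_le_of_disjoint hdisj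
  rw [S.finrank_eq_eight] at this
  omega

/-- The orthogonal complement of a four-dimensional subspace is four-dimensional. -/
theorem eq_orthogonal_of_subset (P Q : Submodule F C) (hP : Module.finrank F P = 4)
    (hQ : Module.finrank F Q = 4) (h : ∀ p ∈ P, p ∈ S.orthogonal (Q : Set C)) :
    (P : Set C) = S.orthogonal Q := by
  have := S.finiteDimensional
  have hmem : ∀ y, y ∈ S.bilinForm.orthogonal Q ↔ y ∈ S.orthogonal (Q : Set C) := by
    intro y
    rw [LinearMap.BilinForm.mem_orthogonal_iff]
    refine forall₂_congr fun c _ => ?_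
    rw [bilinForm_apply, form_comm]
  have heq : P = S.bilinForm.orthogonal Q := by
    refine Submodule.eq_of_le_of_finrank_eq (fun p hp => (hmem p).mpr (h p hp)) ?_
    rw [LinearMap.BilinForm.finrank_orthogonal S.bilinForm_nondegenerate, hP, hQ,
      S.finrank_eq_eight]
  ext y
  rw [← hmem, ← heq]
  rfl

end CayleyDicksonStructure

/-! ### Derivations with invertible values and their kernels -/

namespace IsDerivationWithInvertibleValues

variable {d : C →ₗ[F] C}

theorem map_one (hd : IsDerivationWithInvertibleValues d) : d 1 = 0 := by
  have h := hd.leibniz 1 1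
  rw [mul_one, mul_one, one_mul] at h
  exact left_eq_add.mp h

/-- The kernel of a derivation, as a subalgebra. -/
def kernel (hd : IsDerivationWithInvertibleValues d) : NonUnitalSubalgebra F C where
  __ := LinearMap.ker d
  mul_mem' {a b} ha hb := by
    change d a = 0 at ha
    change d b = 0 at hb
    change d (a * b) = 0
    rw [hd.leibniz, ha, hb, zero_mul, mul_zero, add_zero]

variable (S : CayleyDicksonStructure F C)

theorem norm_ne_zero (hd : IsDerivationWithInvertibleValues d) {x : C} (h : d x ≠ 0) :
    S.norm (d x) ≠ 0 :=
  (S.isInvertibleElement_iff _).mp ((hd.values x).resolve_left h)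

theorem norm_ne_zero_of_map_eq_zero (hd : IsDerivationWithInvertibleValues d) {x : C}
    (h : d x = 0) (hx : x ≠ 0) : S.norm x ≠ 0 := by
  intro hn
  apply hd.ne_zero
  ext y
  have hxy : d (x * y) = x * d y := by rw [hd.leibniz, h, zero_mul, zero_add]
  have h0 : x * d y = 0 := by
    by_contra h0
    rw [← hxy] at h0
    apply hd.norm_ne_zero S h0
    rw [hxy, S.norm_mul, hn, zero_mul]
  by_contra hy
  exact hx (S.eq_zero_of_mul_eq_zero' (hd.norm_ne_zero S hy) h0)

/-- Apply `d` to the quadratic equation of `x` and compare with its linearization at `x, dx`. -/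
theorem trace_map_smul (hd : IsDerivationWithInvertibleValues d) (x : C) :
    S.trace (d x) • x = S.form x (d x) • (1 : C) := by
  have h := congrArg d (S.mul_self x)
  rw [hd.leibniz, map_sub, map_smul, map_smul, hd.map_one, smul_zero, sub_zero, S.mul_add_mul] at h
  rw [S.form_comm]
  linear_combination (norm := module) h

/-- A second application of `d` gives `t(dx) dx = 0`. -/
theorem trace_map (hd : IsDerivationWithInvertibleValues d) (x : C) : S.trace (d x) = 0 := by
  by_contra ht
  have h := congrArg d (hd.trace_map_smul S x)
  rw [map_smul, map_smul, hd.map_one, smul_zero, smul_eq_zero] at h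
  apply ht
  rw [h.resolve_left ht, ← S.form_one_right, S.form_zero_left]

theorem form_map_self (hd : IsDerivationWithInvertibleValues d) (x : C) :
    S.form x (d x) = 0 := by
  have h := hd.trace_map_smul S x
  rw [hd.trace_map, zero_smul, eq_comm, smul_eq_zero] at h
  exact h.resolve_right S.unit_ne_zero

/-- Polarization of `f(x, dx) = 0`: `d` is skew for `f`, whence its values are orthogonal to its
kernel. -/
theorem form_map_add (hd : IsDerivationWithInvertibleValues d) (x y : C) :
    S.form x (d y) + S.form y (d x) = 0 := by
  have h := hd.form_map_self S (x + y)
  rw [map_add, S.form_add_left, S.form_add_right, S.form_add_right, hd.form_map_self,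
    hd.form_map_self] at h
  linear_combination h

variable {B : NonUnitalSubalgebra F C}

theorem map_mem_orthogonal (hd : IsDerivationWithInvertibleValues d)
    (hB : (B : Set C) = {y | d y = 0}) (y : C) : d y ∈ S.orthogonal B := by
  intro b hb
  have hb0 : d b = 0 := by
    rw [hB] at hb
    exact hb
  have h := hd.form_map_add S b y
  rwa [hb0, S.form_zero_right, add_zero, S.form_comm] at h

theorem mem_iff (hB : (B : Set C) = {y | d y = 0}) {y : C} : y ∈ B ↔ d y = 0 :=
  Set.ext_iff.mp hB y

theorem toSubmodule_eq_ker (hB : (B : Set C) = {y | d y = 0}) : B.toSubmodule = d.ker :=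
  SetLike.coe_injective hB

theorem finrank_kernel (S : CayleyDicksonStructure F C) (hd : IsDerivationWithInvertibleValues d)
    (hsplit : IsSplitAlgebra C) : Module.finrank F hd.kernel = 4 := by
  have := S.finiteDimensional
  have h := d.finrank_range_add_finrank_ker
  rw [S.finrank_eq_eight] at h
  have h₁ := S.finrank_le_four_of_anisotropic hsplit d.range (by
    rintro _ ⟨x, rfl⟩ hx
    exact hd.norm_ne_zero S hx)
  have h₂ := S.finrank_le_four_of_anisotropic hsplit d.ker fun x hx hx0 =>
    hd.norm_ne_zero_of_map_eq_zero S hx hx0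
  have h₃ : Module.finrank F hd.kernel = Module.finrank F d.ker := rfl
  omega

theorem finrank_range (S : CayleyDicksonStructure F C) (hB : (B : Set C) = {y | d y = 0})
    (h4 : Module.finrank F B = 4) : Module.finrank F d.range = 4 := by
  have := S.finiteDimensional
  have h := d.finrank_range_add_finrank_ker
  have h₁ : Module.finrank F B.toSubmodule = 4 := h4
  rw [S.finrank_eq_eight, ← toSubmodule_eq_ker hB, h₁] at h
  omega

theorem map_add_mul (hd : IsDerivationWithInvertibleValues d) (hB : (B : Set C) = {y | d y = 0})
    {a b : C} (ha : a ∈ B) (hb : b ∈ B) (w : C) : d (a + w * b) = d w * b := by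
  rw [map_add, hd.leibniz, (mem_iff hB).mp ha, (mem_iff hB).mp hb, mul_zero, add_zero, zero_add]

/-- If the kernel `B` of a derivation is a subfield with `B = B^⊥`, then the derivation is
`a + x b ↦ b` for some `x`. -/
theorem exists_isSumOverSelfOrthogonalSubfield (hd : IsDerivationWithInvertibleValues d)
    (hB : (B : Set C) = {y | d y = 0}) (hfield : IsSubfieldOf B)
    (h4 : Module.finrank F B = 4) (horth : (B : Set C) = S.orthogonal B) :
    ∃ x : C, IsSumOverSelfOrthogonalSubfield S B x ∧ ∀ a ∈ B, ∀ b ∈ B, d (a + x * b) = b := by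
  have hrange : (d.range : Set C) = S.orthogonal B :=
    S.eq_orthogonal_of_subset d.range B.toSubmodule (finrank_range S hB h4) h4 (by
      rintro _ ⟨y, rfl⟩
      exact hd.map_mem_orthogonal S hB y)
  -- The unit lies in `B = B^⊥ = d(C)`; any preimage of it serves as the generator.
  obtain ⟨x, hx⟩ : (1 : C) ∈ (d.range : Set C) := by
    rw [hrange, ← horth]
    exact hfield.one_mem
  have hdx : ∀ a ∈ B, ∀ b ∈ B, d (a + x * b) = b := by
    intro a ha b hb
    rw [hd.map_add_mul hB ha hb, hx, one_mul]
  refine ⟨x, ⟨hfield, h4, horth, ?_, ?_⟩, hdx⟩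
  · rw [← S.form_one_right, ← hx]
    exact hd.form_map_self S x
  · refine S.isDirectSumWith_of_forall_eq_zero h4 fun a ha b hb hab => ?_
    have hb0 : b = 0 := by
      rw [← hdx a ha b hb, hab, map_zero]
    rw [hb0, mul_zero, add_zero] at hab
    exact ⟨hab, hb0⟩

/-- The kernel of a derivation with invertible values satisfies (I) or (II). -/
theorem kernel_cases (hd : IsDerivationWithInvertibleValues d) (hsplit : IsSplitAlgebra C) :
    (∃ (v : C) (γ : F), IsDoubleOfDivisionSubalgebra S hd.kernel v γ) ∨
      ∃ x : C, IsSumOverSelfOrthogonalSubfield S hd.kernel x := by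
  have hB : (hd.kernel : Set C) = {y | d y = 0} := rfl
  set B := hd.kernel
  have h4 : Module.finrank F B = 4 := hd.finrank_kernel S hsplit
  have h1 : (1 : C) ∈ B := hd.map_one
  have hdiv : IsAssociativeDivisionSubalgebra B :=
    S.isAssociativeDivisionSubalgebra_of_anisotropic B h1
      (fun b hb hb0 => hd.norm_ne_zero_of_map_eq_zero S hb hb0) h4
  by_cases hrad : ∀ a ∈ B, a ∈ S.orthogonal B → a = 0
  · left
    obtain ⟨y, hy⟩ : ∃ y, d y ≠ 0 := by
      by_contra! h
      exact hd.ne_zero (LinearMap.ext h)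
    exact ⟨d y, _, S.isDoubleOfDivisionSubalgebra_of_orthogonal hdiv h4 hrad
      (hd.map_mem_orthogonal S hB y) (hd.norm_ne_zero S hy)⟩
  · right
    push Not at hrad
    obtain ⟨a, ha, horth, ha0⟩ := hrad
    -- A nonzero radical element `a` spreads to all of `B`: `n(a)b = a(āb)` is again in the radical.
    have hform : ∀ b ∈ B, ∀ c ∈ B, S.form b c = 0 := by
      intro b hb c hc
      have e := S.conj_mul_mul_self (S.conj a) b
      rw [S.conj_conj, S.norm_conj] at e
      have hab := B.mul_mem (S.conj_mem h1 ha) hb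
      have h0 : S.form (a * (S.conj a * b)) c = 0 := by
        rw [S.form_mul_right]
        exact horth _ (B.mul_mem hc (S.conj_mem h1 hab))
      rw [e, S.form_smul_left] at h0
      exact (mul_eq_zero.mp h0).resolve_left (hd.norm_ne_zero_of_map_eq_zero S ha ha0)
    have hconj : ∀ b ∈ B, S.conj b = -b := fun b hb =>
      S.conj_eq_neg (by rw [← S.form_one_right, hform b hb 1 h1])
    have hneg : ∀ b : C, -b = b := by
      intro b
      have h2 : (2 : F) = 0 := by rw [← S.trace_one, ← S.form_one_right, hform 1 h1 1 h1]
      rw [neg_eq_iff_add_eq_zero, ← two_smul F, h2, zero_smul]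
    -- The involution reverses products and is the identity on `B`, since `b̄ = -b = b`.
    have hfield : IsSubfieldOf B := by
      refine ⟨hdiv, fun b hb c hc => ?_⟩
      rw [← hneg (b * c), ← hconj _ (B.mul_mem hb hc), S.conj_mul, hconj b hb, hconj c hc, hneg,
        hneg]
    obtain ⟨x, hx, -⟩ := hd.exists_isSumOverSelfOrthogonalSubfield S hB hfield h4
      (S.eq_orthogonal_of_subset B.toSubmodule B.toSubmodule h4 h4 hform)
    exact ⟨x, hx⟩

end IsDerivationWithInvertibleValues

/-- In case (I), a derivation with kernel `B` has the form `a + v b ↦ v (b u)`. -/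
theorem IsDoubleOfDivisionSubalgebra.exists_eq_of_derivation {S : CayleyDicksonStructure F C}
    {B : NonUnitalSubalgebra F C} {v : C} {γ : F} (h : IsDoubleOfDivisionSubalgebra S B v γ)
    {d : C →ₗ[F] C} (hd : IsDerivationWithInvertibleValues d) (hB : (B : Set C) = {y | d y = 0}) :
    ∃ u ∈ B, u ≠ 0 ∧ S.trace u = 0 ∧ ∀ a ∈ B, ∀ b ∈ B, d (a + v * b) = v * (b * u) := by
  have h1 := h.division.one_mem
  obtain ⟨a₀, ha₀, u, hu, hvu⟩ := h.directSum.exists_eq (d v)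
  -- Both `dv` and `vu` are orthogonal to `B`, hence so is `a₀`; being in `B` it is also orthogonal
  -- to `vB`, and `f` is nondegenerate.
  have ha₀0 : a₀ = 0 := by
    refine S.eq_zero_of_form_eq_zero fun y => ?_
    obtain ⟨a, ha, b, hb, rfl⟩ := h.directSum.exists_eq y
    have e₁ := hd.map_mem_orthogonal S hB v a ha
    rw [hvu, S.form_add_left, S.mul_mem_orthogonal h1 h.mem_orthogonal hu a ha, add_zero] at e₁
    rw [S.form_add_right, e₁, S.form_comm, S.mul_mem_orthogonal h1 h.mem_orthogonal hb a₀ ha₀,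
      add_zero]
  rw [ha₀0, zero_add] at hvu
  have hform : ∀ a ∈ B, ∀ b ∈ B, d (a + v * b) = v * (b * u) := by
    intro a ha b hb
    rw [hd.map_add_mul hB ha hb, hvu, S.orthogonal_mul_mul h1 h.mem_orthogonal hb hu]
  refine ⟨u, hu, ?_, ?_, hform⟩
  · rintro rfl
    refine hd.ne_zero (LinearMap.ext fun y => ?_)
    obtain ⟨a, ha, b, hb, rfl⟩ := h.directSum.exists_eq y
    rw [hform a ha b hb, mul_zero, mul_zero, LinearMap.zero_apply]
  -- Here `n(v)t(u) = f(vu, v) = f(dv, v) = 0`.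
  · have e := S.form_mul_mul_left v u 1
    rw [mul_one, S.form_one_right, ← hvu, S.form_comm, hd.form_map_self, eq_comm] at e
    exact (mul_eq_zero.mp e).resolve_left h.norm_ne_zero

end

/-! ### The main theorem -/

theorem mainTheorem3 {F C : Type*} [Field F] [NonAssocRing C] [Module F C]
    [IsScalarTower F C C] [SMulCommClass F C C]
    (S : CayleyDicksonStructure F C) (hsplit : IsSplitAlgebra C) :
    -- the criterion
    ((∃ d : C →ₗ[F] C, IsDerivationWithInvertibleValues d) ↔
      (∃ (B : NonUnitalSubalgebra F C) (v : C) (γ : F), IsDoubleOfDivisionSubalgebra S B v γ) ∨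
      (∃ (B : NonUnitalSubalgebra F C) (x : C), IsSumOverSelfOrthogonalSubfield S B x)) ∧
    -- the kernel of every such derivation falls under (I) or (II)
    (∀ d : C →ₗ[F] C, IsDerivationWithInvertibleValues d →
      ∃ B : NonUnitalSubalgebra F C, (B : Set C) = {y | d y = 0} ∧
        ((∃ (v : C) (γ : F), IsDoubleOfDivisionSubalgebra S B v γ) ∨
          (∃ x : C, IsSumOverSelfOrthogonalSubfield S B x))) ∧
    -- the derivations in case (I)
    (∀ (B : NonUnitalSubalgebra F C) (v : C) (γ : F), IsDoubleOfDivisionSubalgebra S B v γ →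
      (∀ d : C →ₗ[F] C, IsDerivationWithInvertibleValues d → (B : Set C) = {y | d y = 0} →
        ∃ u ∈ B, u ≠ 0 ∧ S.trace u = 0 ∧ ∀ a ∈ B, ∀ b ∈ B, d (a + v * b) = v * (b * u)) ∧
      (∃ u ∈ B, u ≠ 0 ∧ S.trace u = 0) ∧
      (∀ u ∈ B, u ≠ 0 → S.trace u = 0 →
        ∃ d : C →ₗ[F] C, IsDerivationWithInvertibleValues d ∧ (B : Set C) = {y | d y = 0} ∧
          ∀ a ∈ B, ∀ b ∈ B, d (a + v * b) = v * (b * u))) ∧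
    -- the derivations in case (II)
    (∀ (B : NonUnitalSubalgebra F C) (x : C), IsSumOverSelfOrthogonalSubfield S B x →
      CharP F 2 ∧
      (∀ d : C →ₗ[F] C, IsDerivationWithInvertibleValues d → (B : Set C) = {y | d y = 0} →
        ∃ x' : C, IsSumOverSelfOrthogonalSubfield S B x' ∧
          ∀ a ∈ B, ∀ b ∈ B, d (a + x' * b) = b) ∧
      (∃ d : C →ₗ[F] C, IsDerivationWithInvertibleValues d ∧ (B : Set C) = {y | d y = 0} ∧
        ∀ a ∈ B, ∀ b ∈ B, d (a + x * b) = b)) := by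
  refine ⟨⟨?_, ?_⟩, ?_, ?_, ?_⟩
  · rintro ⟨d, hd⟩
    rcases hd.kernel_cases S hsplit with ⟨v, γ, h⟩ | ⟨x, h⟩
    · exact Or.inl ⟨_, v, γ, h⟩
    · exact Or.inr ⟨_, x, h⟩
  · rintro (⟨B, v, γ, h⟩ | ⟨B, x, h⟩)
    · obtain ⟨u, hu, hu0, htu⟩ := h.exists_trace_eq_zero
      obtain ⟨d, hd, -⟩ := h.exists_derivation hu hu0 htu
      exact ⟨d, hd⟩
    · obtain ⟨d, hd, -⟩ := h.exists_derivation
      exact ⟨d, hd⟩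
  · exact fun d hd => ⟨hd.kernel, rfl, hd.kernel_cases S hsplit⟩
  · exact fun B v γ h => ⟨fun d hd hB => h.exists_eq_of_derivation hd hB, h.exists_trace_eq_zero,
      fun u hu hu0 htu => h.exists_derivation hu hu0 htu⟩
  · exact fun B x h => ⟨h.charP_two, fun d hd hB =>
      hd.exists_isSumOverSelfOrthogonalSubfield S hB h.subfield h.finrank_eq h.self_orthogonal,
      h.exists_derivation⟩
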